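/- There are absolute constants $c$ and $K$ such that the following holds for all integers $n \ge 0$ and $d \ge 1$. Consider the MPC model with $n$ processors, each with a memory of $c\,d$ words, where a word is an element of a semiring. A round consists of local computation, in which every processor applies semiring operations to the words in its memory without leaving that memory, followed by a simultaneous exchange of messages in which every processor sends at most $c\,d$ words and receives at most $c\,d$ words. Let $E_A, E_B \subseteq [n]\times[n]$ be sets of positions that contain at most $d$ positions in each row and in each column, and let $Q\subseteq[n]\times[n]$ be a set of designated output positions with at most $d$ positions in each row. The sets $E_A$, $E_B$, $Q$ are known in advance. Let the positions in $E_A$, in $E_B$ and in $Q$ each be distributed over the $n$ processors in an arbitrary way in which no processor receives more than $d$ positions of $E_A$, more than $d$ of $E_B$, or more than $d$ of $Q$. Then there is an algorithm with at most $K\,d^{0.9}$ rounds which, for every (not necessarily commutative) semiring $S$ and all $n\times n$ matrices $A$ and $B$ over $S$ whose nonzero entries lie at positions in $E_A$ and $E_B$ respectively, starts with every processor holding only entries of $A$ and $B$ at the positions assigned to it, and ends with every processor holding the entries of the product $AB$ at the positions of $Q$ assigned to it, in pairwise distinct memory words. The algorithm does not depend on $S$ or on the values of the entries of $A$ and $B$.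 -/

import Mathlib

/-! ## The MPC model over a semiring

`P` processors, each with a memory of `M` registers, every register holding one semiring element.
A round consists of local computation, carried out inside the `M` registers with semiring
operations only, followed by a simultaneous exchange of messages in which every processor sends
at most `M` and receives at most `M` semiring elements. -/

namespace MPC

/-- One step of local computation: an operation of the semiring on the registers of a processor.
In every case the first argument is the register which is overwritten. -/
inductive Instr (M : ℕ) where
  | zero (dst : Fin M)
  | one (dst : Fin M)
  | copy (dst src : Fin M)
  | add (dst src₁ src₂ : Fin M)
  | mul (dst src₁ src₂ : Fin M)

/-- The effect of an instruction on the memory of a processor. -/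
def Instr.exec {M : ℕ} {S : Type*} [Semiring S] : Instr M → (Fin M → S) → (Fin M → S)
  | .zero a, m => Function.update m a 0
  | .one a, m => Function.update m a 1
  | .copy a b, m => Function.update m a (m b)
  | .add a b c, m => Function.update m a (m b + m c)
  | .mul a b c, m => Function.update m a (m b * m c)

/-- A local computation is a finite sequence of instructions; its length is not restricted. -/
def runLocal {M : ℕ} {S : Type*} [Semiring S] (prog : List (Instr M)) (m : Fin M → S) :
    Fin M → S :=
  prog.foldl (fun m' i => i.exec m') m

/-- A simultaneous exchange of messages.  If `source q s = some (p, r)`, then processor `p` sends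
the content of its register `r` to processor `q`, which receives it in its register `s`; if
`source q s = none`, then register `s` of `q` keeps its content.  Hence no processor receives more
than `M` words, and `sent_le` says that no processor sends more than `M` words (a word that is
sent to several places is counted once for each of them). -/
structure Exchange (P M : ℕ) where
  source : Fin P → Fin M → Option (Fin P × Fin M)
  sent_le : ∀ p : Fin P,
    (Finset.univ.filter
      (fun x : Fin P × Fin M => (source x.1 x.2).map Prod.fst = some p)).card ≤ M

/-- The effect of an exchange on the memories of all processors. -/
def Exchange.exec {P M : ℕ} {S : Type*} (e : Exchange P M) (σ : Fin P → Fin M → S) :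
    Fin P → Fin M → S :=
  fun q s =>
    match e.source q s with
    | none => σ q s
    | some (p, r) => σ p r

/-- One round: every processor computes locally, and then messages are exchanged. -/
structure Round (P M : ℕ) where
  compute : Fin P → List (Instr M)
  exchange : Exchange P M

/-- The effect of a round on the memories of all processors. -/
def Round.exec {P M : ℕ} {S : Type*} [Semiring S] (ρ : Round P M) (σ : Fin P → Fin M → S) :
    Fin P → Fin M → S :=
  ρ.exchange.exec (fun p => runLocal (ρ.compute p) (σ p))

/-- A protocol: a finite sequence of rounds, and local computation after the last of them. -/
structure Protocol (P M : ℕ) where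
  rounds : List (Round P M)
  final : Fin P → List (Instr M)

/-- The effect of a protocol on the memories of all processors. -/
def Protocol.run {P M : ℕ} {S : Type*} [Semiring S] (π : Protocol P M)
    (σ : Fin P → Fin M → S) : Fin P → Fin M → S :=
  fun p => runLocal (π.final p) (π.rounds.foldl (fun σ' ρ => ρ.exec σ') σ p)

/-! ## Sparse matrix multiplication in the MPC model -/

/-- A set of positions in an `n × n` matrix with at most `d` positions in each row. -/
def RowSparse {n : ℕ} (d : ℕ) (E : Finset (Fin n × Fin n)) : Prop :=
  ∀ i : Fin n, (E.filter (fun e => e.1 = i)).card ≤ d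

/-- A set of positions in an `n × n` matrix with at most `d` positions in each row and at most `d`
positions in each column. -/
def Sparse {n : ℕ} (d : ℕ) (E : Finset (Fin n × Fin n)) : Prop :=
  RowSparse d E ∧ ∀ j : Fin n, (E.filter (fun e => e.2 = j)).card ≤ d

/-- All nonzero entries of the matrix `A` are at positions in `E`. -/
def SupportedOn {n : ℕ} {S : Type*} [Semiring S] (A : Matrix (Fin n) (Fin n) S)
    (E : Finset (Fin n × Fin n)) : Prop :=
  ∀ i j : Fin n, A i j ≠ 0 → (i, j) ∈ E

/-- An even distribution of the positions in `E` over the `n` processors: `own e` is the processor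
responsible for the position `e`, and no processor is responsible for more than `d` positions. -/
def EvenlyDistributed {n : ℕ} (d : ℕ) (E : Finset (Fin n × Fin n))
    (own : Fin n × Fin n → Fin n) : Prop :=
  ∀ p : Fin n, (E.filter (fun e => own e = p)).card ≤ d

/-- A matrix multiplication algorithm on `n` processors with `M` registers each: a protocol,
together with the entries that the registers hold at the start (`Sum.inl (i, k)` is the entry
`(i, k)` of the left factor, `Sum.inr (k, j)` the entry `(k, j)` of the right factor, and a register
without an entry holds `0`) and the register that holds a given entry of the product at the
end. -/
structure MulAlgorithm (n M : ℕ) extends Protocol n M where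
  load : Fin n → Fin M → Option ((Fin n × Fin n) ⊕ (Fin n × Fin n))
  out : Fin n × Fin n → Fin M

/-- The memories of all processors at the start of the algorithm on the input `A`, `B`. -/
def MulAlgorithm.init {n M : ℕ} {S : Type*} [Semiring S] (alg : MulAlgorithm n M)
    (A B : Matrix (Fin n) (Fin n) S) : Fin n → Fin M → S :=
  fun p r =>
    match alg.load p r with
    | none => 0
    | some (Sum.inl (i, k)) => A i k
    | some (Sum.inr (k, j)) => B k j

/-- A processor holds at the start only entries of `A` and `B` that it is responsible for. -/
def MulAlgorithm.StartsFrom {n M : ℕ} (alg : MulAlgorithm n M)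
    (ownA ownB : Fin n × Fin n → Fin n) : Prop :=
  ∀ (p : Fin n) (r : Fin M) (e : Fin n × Fin n),
    (alg.load p r = some (Sum.inl e) → ownA e = p) ∧
      (alg.load p r = some (Sum.inr e) → ownB e = p)

/-- For all matrices `A`, `B` over a semiring whose nonzero entries are at positions in `EA`, `EB`,
the processor responsible for a position `e` in `Q` holds at the end the entry of `A * B` at `e`,
distinct entries in distinct registers. -/
def MulAlgorithm.Computes.{v} {n M : ℕ} (alg : MulAlgorithm n M)
    (EA EB Q : Finset (Fin n × Fin n)) (ownC : Fin n × Fin n → Fin n) : Prop :=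
  (∀ e ∈ Q, ∀ f ∈ Q, ownC e = ownC f → alg.out e = alg.out f → e = f) ∧
    ∀ (S : Type v) [Semiring S] (A B : Matrix (Fin n) (Fin n) S),
      SupportedOn A EA → SupportedOn B EB →
        ∀ e ∈ Q, alg.toProtocol.run (alg.init A B) (ownC e) (alg.out e) = (A * B) e.1 e.2

end MPC

universe u

open Finset

namespace MPC

/-! An entry of the product at a position of `Q` is a sum over triangles `(i, j, k)`, and there are
at most `n * d * d` triangles. Doing `d` triangles per processor and batch would take about `d`
batches. The gain comes from clusters: sets of triangles touching only `O(d)` positions of each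
matrix, yet containing about `d * r` triangles, where `r` is the integer part of `d ^ 0.1`.

As long as at least `n * d * d / r` triangles remain, such a cluster exists
(`exists_compact_subset`). By Cauchy–Schwarz over the output positions, some middle index `j₀` is
joined to both ends of at least `d ^ 3 / r ^ 2` triangles (`exists_middle`). Their outer indices are
neighbours of `j₀`; averaging over groups of about `√d` such indices, and then over groups of middle
indices with few edges to them, isolates a cluster. Clusters are peeled off greedily, and the few
triangles left over are cut into pieces of about `d`. This gives `O(n * d / r + 1)` compact colour
classes (`exists_coloring`).

A batch of `n` classes, one per processor, takes nine rounds (`exists_rounds_of_compact`). An owner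
cannot serve all requests for its words directly, as that may mean `d ^ 2` messages. Words therefore
pass through balanced home processors (`exists_homes`), and partial sums return the same way. With
`O(d / r)` batches the bound `O(d ^ 0.9)` follows. -/

/-! ### Splitting weighted sets into chunks. -/

/-- Weighted items can be split into consecutive chunks of nearly equal weight. -/
theorem exists_chunks {α : Type*} [DecidableEq α] (X : Finset α) (w : α → ℕ) (D W : ℕ)
    (hD : 0 < D) (hw : ∀ x ∈ X, w x ≤ W) :
    ∃ f : α → ℕ, (∀ x ∈ X, f x * D + w x ≤ ∑ y ∈ X, w y) ∧
      ∀ c, ∑ x ∈ X with f x = c, w x ≤ D + W := by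
  -- Stronger induction hypothesis: class `c` receives items only once the running total has reached
  -- `c * D`, so its weight is at most the excess over `c * D`.
  suffices h : ∃ f : α → ℕ, (∀ x ∈ X, f x * D + w x ≤ ∑ y ∈ X, w y) ∧
      ∀ c, ∑ x ∈ X with f x = c, w x ≤ D + W ∧
        ∑ x ∈ X with f x = c, w x ≤ (∑ y ∈ X, w y) - c * D by
    obtain ⟨f, h₁, h₂⟩ := h
    exact ⟨f, h₁, fun c => (h₂ c).1⟩
  induction X using Finset.induction_on with
  | empty => exact ⟨fun _ => 0, by simp, by simp⟩
  | insert a X ha ih =>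
    obtain ⟨f, h₁, h₂⟩ := ih fun x hx => hw x (mem_insert_of_mem hx)
    set s := ∑ y ∈ X, w y with hs
    have hne : ∀ x ∈ X, x ≠ a := fun x hx h => ha (h ▸ hx)
    have hdiv : s / D * D ≤ s := Nat.div_mul_le_self s D
    have hlt : s < s / D * D + D := by
      have := Nat.lt_div_mul_add (a := s) hD
      omega
    have hwa := hw a (mem_insert_self a X)
    refine ⟨Function.update f a (s / D), ?_, fun c => ?_⟩
    · intro x hx
      rw [sum_insert ha]
      rcases mem_insert.1 hx with rfl | hx
      · simp only [Function.update_self]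
        omega
      · rw [Function.update_of_ne (hne x hx)]
        have := h₁ x hx
        omega
    · have hfilter : (X.filter fun x => Function.update f a (s / D) x = c) =
          X.filter fun x => f x = c :=
        filter_congr fun x hx => by rw [Function.update_of_ne (hne x hx)]
      rw [filter_insert, sum_insert ha, hfilter, Function.update_self]
      have h₃ := h₂ c
      split_ifs with hc
      · rw [sum_insert (by simp [ha])]
        subst hc
        omega
      · omega

/-! ### Triangles and their multiplicities. -/

/-- The positions of the left factor, of the right factor and of the product that a triple of
indices involves. -/
def leftPos {n : ℕ} (t : Fin n × Fin n × Fin n) : Fin n × Fin n := (t.1, t.2.1)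

/-- See `leftPos`. -/
def rightPos {n : ℕ} (t : Fin n × Fin n × Fin n) : Fin n × Fin n := (t.2.1, t.2.2)

/-- See `leftPos`. -/
def outPos {n : ℕ} (t : Fin n × Fin n × Fin n) : Fin n × Fin n := (t.1, t.2.2)

/-- The elementary products that contribute to the positions in `Q`. -/
def triangles {n : ℕ} (EA EB Q : Finset (Fin n × Fin n)) : Finset (Fin n × Fin n × Fin n) :=
  univ.filter fun t => leftPos t ∈ EA ∧ rightPos t ∈ EB ∧ outPos t ∈ Q

theorem mem_triangles {n : ℕ} {EA EB Q : Finset (Fin n × Fin n)} {t : Fin n × Fin n × Fin n} :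
    t ∈ triangles EA EB Q ↔ leftPos t ∈ EA ∧ rightPos t ∈ EB ∧ outPos t ∈ Q := by
  simp [triangles]

theorem RowSparse.card_le {n d : ℕ} {E : Finset (Fin n × Fin n)} (h : RowSparse d E) :
    E.card ≤ n * d := by
  have := card_le_mul_card_image (f := Prod.fst) E d fun i _ => h i
  calc E.card ≤ d * (E.image Prod.fst).card := this
    _ ≤ d * n := Nat.mul_le_mul_left d ((card_le_univ _).trans (by simp))
    _ = n * d := Nat.mul_comm d n

/-- Once `(i, j)` is fixed, a triangle is determined by its right position, which lies in row `j` of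
`EB`. This and the two analogues below bound how often a single word is requested or contributed to.
-/
theorem card_triangles_leftPos_le {n d : ℕ} {EA EB Q : Finset (Fin n × Fin n)}
    (hB : Sparse d EB) (e : Fin n × Fin n) :
    ((triangles EA EB Q).filter fun t => leftPos t = e).card ≤ d := by
  refine le_trans (card_le_card_of_injOn rightPos ?_ ?_) (hB.1 e.2)
  · intro t ht
    simp only [coe_filter, mem_triangles, Set.mem_ofPred_eq] at ht ⊢
    exact ⟨ht.1.2.1, by rw [← ht.2]; rfl⟩
  · rintro ⟨i, j, k⟩ ht ⟨i', j', k'⟩ ht' h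
    simp only [leftPos, rightPos] at ht ht' h
    grind

theorem card_triangles_rightPos_le {n d : ℕ} {EA EB Q : Finset (Fin n × Fin n)}
    (hA : Sparse d EA) (e : Fin n × Fin n) :
    ((triangles EA EB Q).filter fun t => rightPos t = e).card ≤ d := by
  refine le_trans (card_le_card_of_injOn leftPos ?_ ?_) (hA.2 e.1)
  · intro t ht
    simp only [coe_filter, mem_triangles, Set.mem_ofPred_eq] at ht ⊢
    exact ⟨ht.1.1, by rw [← ht.2]; rfl⟩
  · rintro ⟨i, j, k⟩ ht ⟨i', j', k'⟩ ht' h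
    simp only [leftPos, rightPos] at ht ht' h
    grind

theorem card_triangles_outPos_le {n d : ℕ} {EA EB Q : Finset (Fin n × Fin n)}
    (hA : Sparse d EA) (e : Fin n × Fin n) :
    ((triangles EA EB Q).filter fun t => outPos t = e).card ≤ d := by
  refine le_trans (card_le_card_of_injOn leftPos ?_ ?_) (hA.1 e.1)
  · intro t ht
    simp only [coe_filter, mem_triangles, Set.mem_ofPred_eq] at ht ⊢
    exact ⟨ht.1.1, by rw [← ht.2]; rfl⟩
  · rintro ⟨i, j, k⟩ ht ⟨i', j', k'⟩ ht' h
    simp only [leftPos, outPos] at ht ht' h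
    grind

theorem card_triangles_le {n d : ℕ} {EA EB Q : Finset (Fin n × Fin n)}
    (hA : Sparse d EA) (hB : Sparse d EB) : (triangles EA EB Q).card ≤ n * d * d := by
  have h := card_le_mul_card_image_of_maps_to (f := leftPos) (s := triangles EA EB Q) (t := EA)
    (fun t ht => (mem_triangles.1 ht).1) d fun e _ => card_triangles_leftPos_le hB e
  calc _ ≤ d * EA.card := h
    _ ≤ d * (n * d) := Nat.mul_le_mul_left d hA.1.card_le
    _ = n * d * d := Nat.mul_comm _ _

/-! ### Clusters in dense sets of triangles. -/

/-- A set of elementary products is compact if it involves few positions of each matrix. -/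
def Compact {n : ℕ} (b : ℕ) (T : Finset (Fin n × Fin n × Fin n)) : Prop :=
  (T.image leftPos).card ≤ b ∧ (T.image rightPos).card ≤ b ∧ (T.image outPos).card ≤ b

theorem Compact.mono {n b : ℕ} {T U : Finset (Fin n × Fin n × Fin n)} (hU : Compact b U)
    (h : T ⊆ U) : Compact b T :=
  ⟨(card_le_card (image_subset_image h)).trans hU.1,
    (card_le_card (image_subset_image h)).trans hU.2.1,
    (card_le_card (image_subset_image h)).trans hU.2.2⟩

/-- Some index `j` is such that many of the triples are linked to it. -/
theorem exists_middle {n d r : ℕ} {Q : Finset (Fin n × Fin n)} (hQ : RowSparse d Q)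
    {T : Finset (Fin n × Fin n × Fin n)} (hTQ : ∀ t ∈ T, outPos t ∈ Q)
    (hT : n * d * d ≤ T.card * r) (hT₀ : T.Nonempty) (hd : 1 ≤ d) :
    ∃ j, d ^ 3 ≤ (T.filter fun t => (t.1, j, t.2.2) ∈ T).card * r ^ 2 := by
  have hn : 0 < n := by
    obtain ⟨t, -⟩ := hT₀
    exact t.1.pos
  by_contra! hcon
  set N : Fin n → ℕ := fun j => (T.filter fun t => (t.1, j, t.2.2) ∈ T).card with hN
  set w : Fin n × Fin n → ℕ := fun q => (T.filter fun t => outPos t = q).card with hw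
  have hsum : T.card = ∑ q ∈ Q, w q := card_eq_sum_card_fiberwise fun t ht => hTQ t ht
  have hcs : T.card ^ 2 ≤ Q.card * ∑ q ∈ Q, w q ^ 2 := by
    rw [hsum]
    exact sq_sum_le_card_mul_sum_sq
  -- Both sides count pairs of triangles with the same output position; `N j` collects those whose
  -- second triangle has middle index `j`.
  have hpairs : ∑ q ∈ Q, w q ^ 2 = ∑ j, N j := by
    have h₁ : ∀ q, w q = ∑ j, if (q.1, j, q.2) ∈ T then 1 else 0 := by
      intro q
      rw [sum_boole, Nat.cast_id]
      refine card_nbij' (fun t => t.2.1) (fun j => (q.1, j, q.2)) ?_ ?_ ?_ ?_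
      · rintro ⟨i, j, k⟩ h
        obtain ⟨h', rfl⟩ := mem_filter.1 (mem_coe.1 h)
        exact mem_coe.2 (mem_filter.2 ⟨mem_univ _, h'⟩)
      · intro j h
        exact mem_coe.2 (mem_filter.2 ⟨(mem_filter.1 (mem_coe.1 h)).2, rfl⟩)
      · rintro ⟨i, j, k⟩ h
        obtain ⟨-, rfl⟩ := mem_filter.1 (mem_coe.1 h)
        rfl
      · intro j _
        rfl
    have h₂ : ∀ j, N j = ∑ q ∈ Q, w q * if (q.1, j, q.2) ∈ T then 1 else 0 := by
      intro j
      simp only [hN]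
      rw [card_eq_sum_card_fiberwise (f := outPos) (t := Q)
        fun t ht => hTQ t (mem_filter.1 ht).1]
      refine sum_congr rfl fun q _ => ?_
      simp only [hw, mul_ite, mul_one, mul_zero, filter_filter]
      split_ifs with h
      · refine congrArg card (filter_congr fun t _ => ?_)
        constructor
        · exact fun h => h.2
        · rintro rfl
          exact ⟨h, rfl⟩
      · rw [card_eq_zero, filter_eq_empty_iff]
        rintro t ht ⟨h', rfl⟩
        exact h h'
    simp only [h₂]
    rw [sum_comm]
    refine sum_congr rfl fun q _ => ?_
    rw [← mul_sum, ← h₁, sq]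
  have hlt : (∑ j, N j) * r ^ 2 < n * d ^ 3 := by
    rw [sum_mul]
    calc ∑ j, N j * r ^ 2 < ∑ _j : Fin n, d ^ 3 :=
          sum_lt_sum_of_nonempty ⟨⟨0, hn⟩, mem_univ _⟩ fun j _ => hcon j
      _ = n * d ^ 3 := by simp
  have h₁ : (n * d * d) ^ 2 ≤ (n * d) * ((∑ j, N j) * r ^ 2) := by
    calc (n * d * d) ^ 2 ≤ (T.card * r) ^ 2 := Nat.pow_le_pow_left hT 2
      _ = T.card ^ 2 * r ^ 2 := mul_pow _ _ _
      _ ≤ (Q.card * ∑ q ∈ Q, w q ^ 2) * r ^ 2 := Nat.mul_le_mul_right _ hcs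
      _ ≤ (n * d * ∑ q ∈ Q, w q ^ 2) * r ^ 2 := by gcongr; exact hQ.card_le
      _ = (n * d) * ((∑ j, N j) * r ^ 2) := by rw [hpairs]; ring
  have h₂ : (n * d) * ((∑ j, N j) * r ^ 2) < (n * d) * (n * d ^ 3) :=
    Nat.mul_lt_mul_of_pos_left hlt (by positivity)
  have h₃ : (n * d * d) ^ 2 = (n * d) * (n * d ^ 3) := by ring
  omega

/-- A dense set of triangles contains a large compact subset. -/
theorem exists_compact_subset {n d r : ℕ} (hd : 1 ≤ d) (hr : r ^ 10 ≤ d)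
    {EA EB Q : Finset (Fin n × Fin n)} (hA : Sparse d EA) (hB : Sparse d EB) (hQ : RowSparse d Q)
    {T : Finset (Fin n × Fin n × Fin n)} (hTT : T ⊆ triangles EA EB Q)
    (hT : n * d * d ≤ T.card * r) (hT₀ : T.Nonempty) :
    ∃ S ⊆ T, Compact (5 * d) S ∧ d * r ≤ 80 * S.card := by
  obtain ⟨j₀, hj₀⟩ := exists_middle hQ (fun t ht => (mem_triangles.1 (hTT ht)).2.2) hT hT₀ hd
  set T₁ := T.filter fun t => (t.1, j₀, t.2.2) ∈ T with hT₁
  set g := d.sqrt with hg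
  have hg₁ : 1 ≤ g := Nat.sqrt_pos.2 hd
  have hgd : g * g ≤ d := Nat.sqrt_le d
  have hdg : d < (g + 1) * (g + 1) := Nat.lt_succ_sqrt d
  have hgled : g ≤ d := Nat.sqrt_le_self d
  -- the neighbours of `j₀`, in groups of size about `g`
  set I := univ.filter fun i => (i, j₀) ∈ EA with hI
  set K := univ.filter fun k => (j₀, k) ∈ EB with hK
  have hIc : I.card ≤ d := by
    refine le_trans (card_le_card_of_injOn (fun i => (i, j₀)) ?_ ?_) (hA.2 j₀)
    · intro i hi; simpa [hI] using hi
    · intro i _ i' _ h; simpa using h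
  have hKc : K.card ≤ d := by
    refine le_trans (card_le_card_of_injOn (fun k => (j₀, k)) ?_ ?_) (hB.1 j₀)
    · intro i hi; simpa [hK] using hi
    · intro i _ i' _ h; simpa using h
  obtain ⟨α, hα, hα'⟩ := exists_chunks I (fun _ => 1) g 1 hg₁ (by simp)
  obtain ⟨β, hβ, hβ'⟩ := exists_chunks K (fun _ => 1) g 1 hg₁ (by simp)
  simp only [sum_const, smul_eq_mul, mul_one] at hα hα' hβ hβ'
  -- There are fewer than `4 * g` groups on either side, since `d < (g + 1) ^ 2 ≤ 4 * g ^ 2`.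
  have hsmall : ∀ m, m * g + 1 ≤ d → m < 4 * g := by
    intro m hm
    by_contra! h
    nlinarith
  have hT₁I : ∀ t ∈ T₁, t.1 ∈ I ∧ t.2.2 ∈ K := by
    intro t ht
    have := mem_triangles.1 (hTT (mem_filter.1 ht).2)
    simp only [hI, hK, mem_filter, mem_univ, true_and]
    exact ⟨this.1, this.2.1⟩
  obtain ⟨⟨a, b⟩, -, hab⟩ : ∃ y ∈ range (4 * g) ×ˢ range (4 * g),
      T₁.card ≤ (16 * g ^ 2) * (T₁.filter fun t => (α t.1, β t.2.2) = y).card := by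
    by_contra! h
    have h₁ : ∀ t ∈ T₁, (α t.1, β t.2.2) ∈ range (4 * g) ×ˢ range (4 * g) := by
      intro t ht
      rw [mem_product, mem_range, mem_range]
      exact ⟨hsmall _ ((hα _ (hT₁I t ht).1).trans hIc), hsmall _ ((hβ _ (hT₁I t ht).2).trans hKc)⟩
    have h₂ := card_eq_sum_card_fiberwise h₁
    have h₃ := sum_lt_sum_of_nonempty ⟨(0, 0), by simp; omega⟩ h
    rw [← mul_sum, ← h₂] at h₃
    simp only [sum_const, card_product, card_range, smul_eq_mul] at h₃
    have : 4 * g * (4 * g) * T₁.card = 16 * g ^ 2 * T₁.card := by ring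
    omega
  set T₂ := T₁.filter fun t => (α t.1, β t.2.2) = (a, b) with hT₂
  set I' := I.filter fun i => α i = a with hI'
  set K' := K.filter fun k => β k = b with hK'
  have hI'c : I'.card ≤ g + 1 := by simpa using hα' a
  have hK'c : K'.card ≤ g + 1 := by simpa using hβ' b
  have hT₂I : ∀ t ∈ T₂, t.1 ∈ I' ∧ t.2.2 ∈ K' := by
    intro t ht
    obtain ⟨ht, hy⟩ := mem_filter.1 ht
    rw [Prod.mk.injEq] at hy
    exact ⟨mem_filter.2 ⟨(hT₁I t ht).1, hy.1⟩, mem_filter.2 ⟨(hT₁I t ht).2, hy.2⟩⟩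
  -- the middle indices, in groups with few edges to the chosen groups
  set wA : Fin n → ℕ := fun j => (I'.filter fun i => (i, j) ∈ EA).card with hwA
  set wB : Fin n → ℕ := fun j => (K'.filter fun k => (j, k) ∈ EB).card with hwB
  have hw : ∀ j ∈ (univ : Finset (Fin n)), wA j + wB j ≤ 2 * (g + 1) := by
    intro j _
    have h₁ : wA j ≤ g + 1 := (card_filter_le _ _).trans hI'c
    have h₂ : wB j ≤ g + 1 := (card_filter_le _ _).trans hK'c
    omega
  have hwsum : ∑ j, (wA j + wB j) ≤ 2 * (g + 1) * d := by
    have h₁ : ∑ j, wA j ≤ (g + 1) * d := by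
      simp only [hwA, card_filter]
      rw [sum_comm]
      refine (sum_le_card_nsmul _ _ d fun i _ => ?_).trans
        (by rw [smul_eq_mul]; exact Nat.mul_le_mul_right d hI'c)
      rw [← card_filter]
      refine le_trans (card_le_card_of_injOn (fun j => (i, j)) ?_ ?_) (hA.1 i)
      · intro j hj; simpa using hj
      · intro j _ j' _ h; simpa using h
    have h₂ : ∑ j, wB j ≤ (g + 1) * d := by
      simp only [hwB, card_filter]
      rw [sum_comm]
      refine (sum_le_card_nsmul _ _ d fun k _ => ?_).trans
        (by rw [smul_eq_mul]; exact Nat.mul_le_mul_right d hK'c)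
      rw [← card_filter]
      refine le_trans (card_le_card_of_injOn (fun j => (j, k)) ?_ ?_) (hB.2 k)
      · intro j hj; simpa using hj
      · intro j _ j' _ h; simpa using h
    rw [sum_add_distrib]
    linarith
  -- Weighing `j` by its edges to `I'` and `K'` gives each class at most `d + 2 * (g + 1) ≤ 5 * d`
  -- edges. As the total weight is at most `2 * (g + 1) * d`, every label is at most `2 * (g + 1) <
  -- 5 * g`.
  obtain ⟨γ, hγ, hγ'⟩ := exists_chunks univ (fun j => wA j + wB j) d (2 * (g + 1)) hd hw
  obtain ⟨c, -, hc⟩ : ∃ c ∈ range (5 * g),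
      T₂.card ≤ (5 * g) * (T₂.filter fun t => γ t.2.1 = c).card := by
    by_contra! h
    have h₁ : ∀ t ∈ T₂, γ t.2.1 ∈ range (5 * g) := by
      intro t _
      rw [mem_range]
      have h₂ : γ t.2.1 * d ≤ 2 * (g + 1) * d :=
        (Nat.le_add_right _ _).trans ((hγ t.2.1 (mem_univ _)).trans hwsum)
      have := Nat.le_of_mul_le_mul_right h₂ hd
      omega
    have h₂ := card_eq_sum_card_fiberwise h₁
    have h₃ := sum_lt_sum_of_nonempty ⟨0, by simp; omega⟩ h
    rw [← mul_sum, ← h₂] at h₃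
    simp at h₃
  set T₃ := T₂.filter fun t => γ t.2.1 = c with hT₃
  have hT₃T : T₃ ⊆ T := (filter_subset _ _).trans ((filter_subset _ _).trans (filter_subset _ _))
  have hT₃I : ∀ t ∈ T₃, t.1 ∈ I' ∧ t.2.2 ∈ K' ∧ γ t.2.1 = c := fun t ht =>
    ⟨(hT₂I t (mem_filter.1 ht).1).1, (hT₂I t (mem_filter.1 ht).1).2, (mem_filter.1 ht).2⟩
  have hclass := hγ' c
  rw [sum_add_distrib] at hclass
  refine ⟨T₃, hT₃T, ⟨?_, ?_, ?_⟩, ?_⟩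
  · have h₁ : T₃.image leftPos ⊆
        ((univ.filter fun j => γ j = c).sigma fun j => I'.filter fun i => (i, j) ∈ EA).image
          fun x => (x.2, x.1) := by
      intro e he
      obtain ⟨t, ht, rfl⟩ := mem_image.1 he
      refine mem_image.2 ⟨⟨t.2.1, t.1⟩, ?_, rfl⟩
      simp only [mem_sigma, mem_filter, mem_univ, true_and]
      exact ⟨(hT₃I t ht).2.2, (hT₃I t ht).1, (mem_triangles.1 (hTT (hT₃T ht))).1⟩
    have h₂ := (card_le_card h₁).trans card_image_le
    rw [card_sigma] at h₂
    simp only [hwA, hwB] at hclass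
    omega
  · have h₁ : T₃.image rightPos ⊆
        ((univ.filter fun j => γ j = c).sigma fun j => K'.filter fun k => (j, k) ∈ EB).image
          fun x => (x.1, x.2) := by
      intro e he
      obtain ⟨t, ht, rfl⟩ := mem_image.1 he
      refine mem_image.2 ⟨⟨t.2.1, t.2.2⟩, ?_, rfl⟩
      simp only [mem_sigma, mem_filter, mem_univ, true_and]
      exact ⟨(hT₃I t ht).2.2, (hT₃I t ht).2.1, (mem_triangles.1 (hTT (hT₃T ht))).2.1⟩
    have h₂ := (card_le_card h₁).trans card_image_le
    rw [card_sigma] at h₂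
    simp only [hwA, hwB] at hclass
    omega
  · have h₁ : T₃.image outPos ⊆ I' ×ˢ K' := by
      intro e he
      obtain ⟨t, ht, rfl⟩ := mem_image.1 he
      exact mem_product.2 ⟨(hT₃I t ht).1, (hT₃I t ht).2.1⟩
    have h₂ := card_le_card h₁
    rw [card_product] at h₂
    have h₃ := Nat.mul_le_mul hI'c hK'c
    nlinarith
  -- The two averagings lose factors `16 * g ^ 2` and `5 * g`. What remains is at least `d * r / 80`
  -- because `r ^ 3 ≤ g` and `g * g ≤ d`.
  · have h₁ : d ^ 3 ≤ 80 * T₃.card * (g ^ 3 * r ^ 2) := by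
      calc d ^ 3 ≤ T₁.card * r ^ 2 := hj₀
        _ ≤ (16 * g ^ 2 * T₂.card) * r ^ 2 := Nat.mul_le_mul_right _ hab
        _ ≤ (16 * g ^ 2 * (5 * g * T₃.card)) * r ^ 2 := by gcongr
        _ = 80 * T₃.card * (g ^ 3 * r ^ 2) := by ring
    by_contra! h
    have hr₀ : 0 < r := Nat.pos_of_ne_zero (by rintro rfl; simp at h)
    have hrg : r ^ 3 ≤ g := by
      rw [hg, Nat.le_sqrt]
      calc r ^ 3 * r ^ 3 = r ^ 6 := by ring
        _ ≤ r ^ 10 := Nat.pow_le_pow_right hr₀ (by norm_num)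
        _ ≤ d := hr
    have h₂ : 80 * T₃.card * (g ^ 3 * r ^ 2) < d * r * (g ^ 3 * r ^ 2) :=
      Nat.mul_lt_mul_of_pos_right h (by positivity)
    have h₃ : d * r * (g ^ 3 * r ^ 2) ≤ d ^ 3 := by
      calc d * r * (g ^ 3 * r ^ 2) = d * (r ^ 3 * g * (g * g)) := by ring
        _ ≤ d * (g * g * (g * g)) := by gcongr
        _ ≤ d * (d * d) := by gcongr
        _ = d ^ 3 := by ring
    omega

/-! ### Greedy colouring by compact classes. -/

/-- The triangles can be coloured with few colours so that all colour classes are compact. -/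
theorem exists_coloring {n d r : ℕ} (hd : 1 ≤ d) (hr : r ^ 10 ≤ d)
    {EA EB Q : Finset (Fin n × Fin n)} (hA : Sparse d EA) (hB : Sparse d EB) (hQ : RowSparse d Q)
    (T : Finset (Fin n × Fin n × Fin n)) (hTT : T ⊆ triangles EA EB Q) :
    ∃ (f : Fin n × Fin n × Fin n → ℕ) (N : ℕ), (∀ t ∈ T, f t < N) ∧
      (∀ c, Compact (5 * d) (T.filter fun t => f t = c)) ∧
      N * (d * r) ≤ 80 * T.card + n * d * d + d * r := by
  induction hm : T.card using Nat.strong_induction_on generalizing T with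
  | _ m ih =>
    -- Dense case: a cluster gets a colour of its own, paid for by its `d * r / 80` triangles.
    -- Sparse case: arbitrary chunks of at most `d + 1` triangles are compact and few.
    by_cases hsmall : n * d * d ≤ T.card * r ∧ T.Nonempty
    · obtain ⟨S, hST, hS, hScard⟩ := exists_compact_subset hd hr hA hB hQ hTT hsmall.1 hsmall.2
      by_cases hr₀ : r = 0
      · have h₀ : n * d * d = 0 := by simpa [hr₀] using hsmall.1
        obtain ⟨t, -⟩ := hsmall.2
        have : 0 < n * d * d := by have := t.1.pos; positivity
        omega
      -- This makes `S` nonempty, so the induction on the cardinality applies to `T \ S`.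
      have hdr : 0 < d * r := by positivity
      have hsub : (T \ S).card + S.card = T.card := card_sdiff_add_card_eq_card hST
      obtain ⟨f, N, h₁, h₂, h₃⟩ :=
        ih (T \ S).card (by omega) (T \ S) (sdiff_subset.trans hTT) rfl
      refine ⟨fun t => if t ∈ S then N else f t, N + 1, ?_, ?_, ?_⟩
      · intro t ht
        dsimp only
        split_ifs with h
        · omega
        · have := h₁ t (mem_sdiff.2 ⟨ht, h⟩)
          omega
      · intro c
        by_cases hc : c = N
        · refine hS.mono fun t ht => ?_
          obtain ⟨ht, hf⟩ := mem_filter.1 ht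
          dsimp only at hf
          by_contra h
          rw [if_neg h] at hf
          have := h₁ t (mem_sdiff.2 ⟨ht, h⟩)
          omega
        · refine (h₂ c).mono fun t ht => ?_
          obtain ⟨ht, hf⟩ := mem_filter.1 ht
          dsimp only at hf
          split_ifs at hf with h
          · exact absurd hf.symm hc
          · exact mem_filter.2 ⟨mem_sdiff.2 ⟨ht, h⟩, hf⟩
      · rw [add_mul, one_mul]
        omega
    · have hle : T.card * r ≤ n * d * d := by
        by_contra! h
        refine hsmall ⟨h.le, card_pos.1 (Nat.pos_of_ne_zero fun h₀ => ?_)⟩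
        simp [h₀] at h
      obtain ⟨f, h₁, h₂⟩ := exists_chunks T (fun _ => 1) d 1 hd (by simp)
      simp only [sum_const, smul_eq_mul, mul_one] at h₁ h₂
      refine ⟨f, T.card / d + 1, fun t ht => ?_, fun c => ?_, ?_⟩
      · rw [Nat.lt_succ_iff, Nat.le_div_iff_mul_le hd]
        have := h₁ t ht
        omega
      · have h : (T.filter fun t => f t = c).card ≤ 5 * d := by
          have := h₂ c
          omega
        exact ⟨card_image_le.trans h, card_image_le.trans h, card_image_le.trans h⟩
      · have : T.card / d * d * r ≤ n * d * d :=
          (Nat.mul_le_mul_right r (Nat.div_mul_le_self _ _)).trans hle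
        calc (T.card / d + 1) * (d * r) = T.card / d * d * r + d * r := by ring
          _ ≤ _ := by omega

/-! ### Register allocation, local programs and single rounds. -/

/-- Words can be assigned to registers such that words on the same processor do not collide. -/
theorem exists_slots {α : Type*} [DecidableEq α] {n s : ℕ} (hs : 0 < s) (X : Finset α)
    (proc : α → Fin n) (hX : ∀ p, (X.filter fun x => proc x = p).card ≤ s) :
    ∃ i : α → Fin s, ∀ x ∈ X, ∀ y ∈ X, proc x = proc y → i x = i y → x = y := by
  have h : ∀ p, ∃ i : α → Fin s, Set.InjOn i (X.filter fun x => proc x = p) := by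
    intro p
    refine ⟨fun x => if hx : x ∈ X.filter fun x => proc x = p then
      Fin.castLE (hX p) ((X.filter fun x => proc x = p).equivFin ⟨x, hx⟩) else ⟨0, hs⟩, ?_⟩
    intro x hx y hy hxy
    rw [mem_coe] at hx hy
    dsimp only at hxy
    rw [dif_pos hx, dif_pos hy] at hxy
    simpa using Fin.castLE_injective _ hxy
  choose i hi using h
  refine ⟨fun x => i (proc x) x, fun x hx y hy hp hxy => ?_⟩
  refine hi (proc x) (by simpa using hx) (by simp [hy, hp]) ?_
  dsimp only at hxy
  rwa [← hp] at hxy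

theorem runLocal_append {M : ℕ} {S : Type*} [Semiring S] (L L' : List (Instr M)) (m : Fin M → S) :
    runLocal (L ++ L') m = runLocal L' (runLocal L m) :=
  List.foldl_append

/-- Instructions adding a product of two registers to a third one, by way of a register `u`. -/
def fma {M : ℕ} (u : Fin M) (x : Fin M × Fin M × Fin M) : List (Instr M) :=
  [.mul u x.2.1 x.2.2, .add x.1 x.1 u]

theorem runLocal_fma {M : ℕ} {S : Type*} [Semiring S] {u : Fin M}
    {x : Fin M × Fin M × Fin M} (hx : x.1 ≠ u) (m : Fin M → S) {z : Fin M} (hz : z ≠ u) :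
    runLocal (fma u x) m z = m z + if x.1 = z then m x.2.1 * m x.2.2 else 0 := by
  obtain ⟨a, b, c⟩ := x
  dsimp only at hx ⊢
  by_cases h : a = z
  · subst h
    simp [fma, runLocal, Instr.exec, Function.update_of_ne hx]
  · simp [fma, runLocal, Instr.exec, Function.update_of_ne (Ne.symm h),
      Function.update_of_ne hz, h]

/-- No target register is also a factor, so every product is formed from the initial values and the
order of execution does not matter. -/
theorem runLocal_flatMap_fma {M : ℕ} {S : Type*} [Semiring S] {u : Fin M}
    (L : List (Fin M × Fin M × Fin M)) (hu : ∀ x ∈ L, x.1 ≠ u ∧ x.2.1 ≠ u ∧ x.2.2 ≠ u)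
    (hL : ∀ x ∈ L, ∀ y ∈ L, y.1 ≠ x.2.1 ∧ y.1 ≠ x.2.2) (m : Fin M → S) {z : Fin M} (hz : z ≠ u) :
    runLocal (L.flatMap (fma u)) m z =
      m z + (L.map fun x => if x.1 = z then m x.2.1 * m x.2.2 else 0).sum := by
  induction L generalizing m with
  | nil => simp [runLocal]
  | cons a L ih =>
    rw [List.flatMap_cons, runLocal_append,
      ih (fun x hx => hu x (List.mem_cons_of_mem a hx))
        (fun x hx y hy => hL x (List.mem_cons_of_mem a hx) y (List.mem_cons_of_mem a hy)),
      runLocal_fma (hu a List.mem_cons_self).1 m hz, List.map_cons, List.sum_cons, ← add_assoc]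
    congr 2
    refine List.map_congr_left fun x hx => ?_
    have h := hu x (List.mem_cons_of_mem a hx)
    have h' := hL x (List.mem_cons_of_mem a hx) a List.mem_cons_self
    rw [runLocal_fma (hu a List.mem_cons_self).1 m h.2.1,
      runLocal_fma (hu a List.mem_cons_self).1 m h.2.2, if_neg h'.1, if_neg h'.2, add_zero,
      add_zero]

theorem runLocal_map_zero {M : ℕ} {S : Type*} [Semiring S] (L : List (Fin M)) (m : Fin M → S)
    (z : Fin M) : runLocal (L.map Instr.zero) m z = if z ∈ L then 0 else m z := by
  induction L generalizing m with
  | nil => simp [runLocal]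
  | cons a L ih =>
    have h : runLocal ((a :: L).map Instr.zero) m =
        runLocal (L.map Instr.zero) (Function.update m a 0) := rfl
    rw [h, ih]
    by_cases hz : z = a
    · subst hz; simp
    · simp [hz]

/-- A round without messages. -/
def Round.ofCompute {P M : ℕ} (prog : Fin P → List (Instr M)) : Round P M where
  compute := prog
  exchange := ⟨fun _ _ => none, by simp⟩

theorem Round.ofCompute_exec {P M : ℕ} {S : Type*} [Semiring S] (prog : Fin P → List (Instr M))
    (σ : Fin P → Fin M → S) (p : Fin P) :
    (Round.ofCompute prog).exec σ p = runLocal (prog p) (σ p) := rfl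

/-! Memories are divided into ten regions of `s` registers by an injective map `reg`. -/

/-- A round which moves words from region `kS` to region `kD`. -/
theorem exists_transfer.{v} {α : Type*} [DecidableEq α] {n M s : ℕ} {reg : Fin 10 × Fin s → Fin M}
    (hreg : Function.Injective reg) (X : Finset α) (pS pD : α → Fin n) (kS kD : Fin 10)
    (iS iD : α → Fin s) (hinj : ∀ x ∈ X, ∀ y ∈ X, pD x = pD y → iD x = iD y → x = y)
    (hsend : ∀ p, (X.filter fun x => pS x = p).card ≤ s) :
    ∃ ρ : Round n M, ∀ (S : Type v) [Semiring S] (σ : Fin n → Fin M → S),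
      (∀ x ∈ X, ρ.exec σ (pD x) (reg (kD, iD x)) = σ (pS x) (reg (kS, iS x))) ∧
        ∀ p k j, k ≠ kD → ρ.exec σ p (reg (k, j)) = σ p (reg (k, j)) := by
  classical
  have hsM : s ≤ M := by
    have := Fintype.card_le_of_injective reg hreg
    simp only [Fintype.card_prod, Fintype.card_fin] at this
    omega
  let source : Fin n → Fin M → Option (Fin n × Fin M) := fun q r =>
    if h : ∃ x ∈ X, pD x = q ∧ reg (kD, iD x) = r then
      some (pS h.choose, reg (kS, iS h.choose)) else none
  have hsent : ∀ p : Fin n, (univ.filter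
      (fun x : Fin n × Fin M => (source x.1 x.2).map Prod.fst = some p)).card ≤ M := by
    intro p
    refine le_trans (card_le_card (t := (X.filter fun x => pS x = p).image
      fun x => (pD x, reg (kD, iD x))) ?_) (card_image_le.trans ((hsend p).trans hsM))
    rintro ⟨q, r⟩ hqr
    simp only [source, mem_filter, mem_univ, true_and] at hqr
    split_ifs at hqr with h
    · obtain ⟨h₁, h₂, h₃⟩ := h.choose_spec
      simp only [Option.map_some, Option.some.injEq] at hqr
      exact mem_image.2 ⟨h.choose, mem_filter.2 ⟨h₁, hqr⟩, by rw [h₂, h₃]⟩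
    · simp at hqr
  refine ⟨⟨fun _ => [], ⟨source, hsent⟩⟩, fun S _ σ => ⟨fun x hx => ?_, fun p k j hk => ?_⟩⟩
  · have h : ∃ y ∈ X, pD y = pD x ∧ reg (kD, iD y) = reg (kD, iD x) := ⟨x, hx, rfl, rfl⟩
    obtain ⟨h₁, h₂, h₃⟩ := h.choose_spec
    have h₄ : h.choose = x := hinj _ h₁ _ hx h₂ (Prod.ext_iff.1 (hreg h₃)).2
    have h₅ : source (pD x) (reg (kD, iD x)) = some (pS x, reg (kS, iS x)) := by
      simp only [source]
      rw [dif_pos h, h₄]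
    simp [Round.exec, Exchange.exec, h₅, runLocal]
  · have h₅ : source p (reg (k, j)) = none := by
      simp only [source]
      rw [dif_neg]
      rintro ⟨x, -, -, hx⟩
      exact hk (Prod.ext_iff.1 (hreg hx)).1.symm
    simp [Round.exec, Exchange.exec, h₅, runLocal]

/-- A round which adds products of words in the regions `ka` and `kb` to words in region `kd`. -/
theorem exists_fma.{v} {α : Type*} [DecidableEq α] {n M s : ℕ} (hs : 0 < s)
    {reg : Fin 10 × Fin s → Fin M} (hreg : Function.Injective reg) (X : Finset α)
    (proc : α → Fin n) (kd ka kb : Fin 10) (id ia ib : α → Fin s) (hka : ka ≠ kd) (hkb : kb ≠ kd)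
    (hd9 : kd ≠ 9) (ha9 : ka ≠ 9) (hb9 : kb ≠ 9) :
    ∃ ρ : Round n M, ∀ (S : Type v) [Semiring S] (σ : Fin n → Fin M → S),
      (∀ p j, ρ.exec σ p (reg (kd, j)) = σ p (reg (kd, j)) +
        ∑ x ∈ X with proc x = p ∧ id x = j, σ p (reg (ka, ia x)) * σ p (reg (kb, ib x))) ∧
        ∀ p k j, k ≠ kd → k ≠ 9 → ρ.exec σ p (reg (k, j)) = σ p (reg (k, j)) := by
  have hne : ∀ {k l : Fin 10} {i j : Fin s}, k ≠ l → reg (k, i) ≠ reg (l, j) :=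
    fun h h' => h (Prod.ext_iff.1 (hreg h')).1
  let ops : Fin n → List (Fin M × Fin M × Fin M) := fun p =>
    (X.filter fun x => proc x = p).toList.map fun x =>
      (reg (kd, id x), reg (ka, ia x), reg (kb, ib x))
  have key : ∀ (S : Type v) [Semiring S] (σ : Fin n → Fin M → S) p k j, k ≠ 9 →
      (Round.ofCompute fun p => (ops p).flatMap (fma (reg (9, ⟨0, hs⟩)))).exec σ p (reg (k, j)) =
        σ p (reg (k, j)) + ∑ x ∈ X with proc x = p, if reg (kd, id x) = reg (k, j) then
          σ p (reg (ka, ia x)) * σ p (reg (kb, ib x)) else 0 := by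
    intro S _ σ p k j hk
    rw [Round.ofCompute_exec, runLocal_flatMap_fma _ _ _ _ (hne hk)]
    · simp only [ops, List.map_map]
      rw [← sum_map_toList]
      rfl
    · intro x hx
      obtain ⟨y, -, rfl⟩ := List.mem_map.1 hx
      exact ⟨hne hd9, hne ha9, hne hb9⟩
    · intro x hx y hy
      obtain ⟨x, -, rfl⟩ := List.mem_map.1 hx
      obtain ⟨y, -, rfl⟩ := List.mem_map.1 hy
      exact ⟨hne hka.symm, hne hkb.symm⟩
  refine ⟨Round.ofCompute fun p => (ops p).flatMap (fma (reg (9, ⟨0, hs⟩))),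
    fun S _ σ => ⟨fun p j => ?_, fun p k j hk hk9 => ?_⟩⟩
  · rw [key S σ p kd j hd9, ← sum_filter, filter_filter]
    congr 2
    ext x
    simp [hreg.eq_iff]
  · rw [key S σ p k j hk9, sum_eq_zero, add_zero]
    intro x _
    rw [if_neg (hne hk.symm)]

/-- A round which sets all words in region `k` to zero. -/
theorem exists_clear.{v} (n : ℕ) {M s : ℕ} {reg : Fin 10 × Fin s → Fin M}
    (hreg : Function.Injective reg) (k : Fin 10) :
    ∃ ρ : Round n M, ∀ (S : Type v) [Semiring S] (σ : Fin n → Fin M → S),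
      (∀ p j, ρ.exec σ p (reg (k, j)) = 0) ∧
        ∀ p l j, l ≠ k → ρ.exec σ p (reg (l, j)) = σ p (reg (l, j)) := by
  refine ⟨Round.ofCompute fun _ => (univ.toList.map fun j => reg (k, j)).map Instr.zero,
    fun S _ σ => ⟨fun p j => ?_, fun p l j hl => ?_⟩⟩
  · rw [Round.ofCompute_exec, runLocal_map_zero, if_pos]
    simp
  · rw [Round.ofCompute_exec, runLocal_map_zero, if_neg]
    simp only [List.mem_map, mem_toList, mem_univ, true_and, not_exists]
    exact fun i h => hl (Prod.ext_iff.1 (hreg h)).1.symm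

/-! ### Routing one batch through home processors. -/

/-- The words `x ∈ X` with values `val x` are stored in region `k` on processors `proc x`. -/
def Stores {α : Type*} {S : Type*} {n M s : ℕ} (reg : Fin 10 × Fin s → Fin M)
    (σ : Fin n → Fin M → S) (k : Fin 10) (X : Finset α) (proc : α → Fin n) (i : α → Fin s)
    (val : α → S) : Prop :=
  ∀ x ∈ X, σ (proc x) (reg (k, i x)) = val x

/-- The effect of a sequence of rounds. -/
def runRounds {P M : ℕ} {S : Type*} [Semiring S] (L : List (Round P M)) (σ : Fin P → Fin M → S) :
    Fin P → Fin M → S :=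
  L.foldl (fun σ' ρ => ρ.exec σ') σ

/-- If the products `t ∈ T` are assigned to processors in such a way that no processor needs more
than `s` inputs for them and contributes to more than `s` outputs, and if there are intermediate
places for the inputs and the outputs through which no more than `s` words per processor have to
be sent, then nine rounds suffice to add all these products to the outputs. -/
theorem exists_rounds_of_homes.{v} {ι κ τ : Type} [DecidableEq ι] [DecidableEq κ] [DecidableEq τ]
    {n M s : ℕ} (hs : 0 < s) {reg : Fin 10 × Fin s → Fin M} (hreg : Function.Injective reg)
    {X : Finset ι} {Q : Finset κ} {T : Finset τ}
    {own : ι → Fin n} {ownC : κ → Fin n} {proc : τ → Fin n} {in₁ in₂ : τ → ι} {out : τ → κ}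
    {i₀ : ι → Fin s} {i₇ : κ → Fin s}
    (hown : ∀ p, (X.filter fun e => own e = p).card ≤ s)
    (hi₇ : ∀ e ∈ Q, ∀ f ∈ Q, ownC e = ownC f → i₇ e = i₇ f → e = f)
    {D : Finset (ι × Fin n)} {G : Finset (κ × Fin n)}
    (hDX : ∀ x ∈ D, x.1 ∈ X) (hGQ : ∀ x ∈ G, x.1 ∈ Q)
    (hin₁ : ∀ t ∈ T, (in₁ t, proc t) ∈ D) (hin₂ : ∀ t ∈ T, (in₂ t, proc t) ∈ D)
    (hout : ∀ t ∈ T, (out t, proc t) ∈ G)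
    (hD : ∀ p, (D.filter fun x => x.2 = p).card ≤ s)
    (hG : ∀ p, (G.filter fun x => x.2 = p).card ≤ s)
    {home : ι → Fin n} {homeC : κ → Fin n}
    (hhome : ∀ p, (X.filter fun e => home e = p).card ≤ s)
    (hhomeD : ∀ p, (D.filter fun x => home x.1 = p).card ≤ s)
    (hhomeC : ∀ p, (Q.filter fun e => homeC e = p).card ≤ s)
    (hhomeG : ∀ p, (G.filter fun x => homeC x.1 = p).card ≤ s) :
    ∃ L : List (Round n M), L.length = 9 ∧
      ∀ (S : Type v) [Semiring S] (σ : Fin n → Fin M → S) (val : ι → S) (acc : κ → S),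
        Stores reg σ 0 X own i₀ val → Stores reg σ 7 Q ownC i₇ acc →
        (∀ p, σ p (reg (8, ⟨0, hs⟩)) = 1) →
        Stores reg (runRounds L σ) 0 X own i₀ val ∧
          Stores reg (runRounds L σ) 7 Q ownC i₇
            (fun f => acc f + ∑ t ∈ T with out t = f, val (in₁ t) * val (in₂ t)) ∧
          ∀ p, runRounds L σ p (reg (8, ⟨0, hs⟩)) = 1 := by
  obtain ⟨i₁, hi₁⟩ := exists_slots hs X home hhome
  obtain ⟨i₂, hi₂⟩ := exists_slots hs D (fun x => x.2) hD
  obtain ⟨i₃, hi₃⟩ := exists_slots hs G (fun x => x.2) hG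
  obtain ⟨i₄, hi₄⟩ := exists_slots hs G (fun x => homeC x.1) hhomeG
  obtain ⟨i₅, hi₅⟩ := exists_slots hs Q homeC hhomeC
  -- Regions: 0 owned inputs, 1 inputs at home, 2 requested copies, 3 partial sums, 4 partial sums
  -- at the output's home, 5 their totals, 6 totals at the owner, 7 accumulated output, 8 the
  -- constant one, 9 scratch.
  obtain ⟨ρ₁, h₁⟩ := exists_transfer.{v} hreg X own home 0 1 i₀ i₁ hi₁ hown
  obtain ⟨ρ₂, h₂⟩ := exists_transfer.{v} hreg D (fun x => home x.1) (fun x => x.2) 1 2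
    (fun x => i₁ x.1) i₂ hi₂ hhomeD
  obtain ⟨ρ₃, h₃⟩ := exists_clear.{v} n hreg 3
  obtain ⟨ρ₄, h₄⟩ := exists_fma.{v} hs hreg T proc 3 2 2 (fun t => i₃ (out t, proc t))
    (fun t => i₂ (in₁ t, proc t)) (fun t => i₂ (in₂ t, proc t))
    (by decide) (by decide) (by decide) (by decide) (by decide)
  obtain ⟨ρ₅, h₅⟩ := exists_transfer.{v} hreg G (fun x => x.2) (fun x => homeC x.1) 3 4
    i₃ i₄ hi₄ hG
  obtain ⟨ρ₆, h₆⟩ := exists_clear.{v} n hreg 5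
  -- Multiplying by the constant in region 8 turns the multiply-add round into plain addition.
  obtain ⟨ρ₇, h₇⟩ := exists_fma.{v} hs hreg G (fun x => homeC x.1) 5 4 8 (fun x => i₅ x.1) i₄
    (fun _ => ⟨0, hs⟩) (by decide) (by decide) (by decide) (by decide) (by decide)
  obtain ⟨ρ₈, h₈⟩ := exists_transfer.{v} hreg Q homeC ownC 5 6 i₅ i₇ hi₇ hhomeC
  obtain ⟨ρ₉, h₉⟩ := exists_fma.{v} hs hreg Q ownC 7 6 8 i₇ i₇
    (fun _ => ⟨0, hs⟩) (by decide) (by decide) (by decide) (by decide) (by decide)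
  refine ⟨[ρ₁, ρ₂, ρ₃, ρ₄, ρ₅, ρ₆, ρ₇, ρ₈, ρ₉], rfl, fun S _ σ val acc hval hacc hone => ?_⟩
  change Stores reg (ρ₉.exec (ρ₈.exec (ρ₇.exec (ρ₆.exec (ρ₅.exec (ρ₄.exec (ρ₃.exec (ρ₂.exec
    (ρ₁.exec σ))))))))) 0 X own i₀ val ∧ Stores reg (ρ₉.exec (ρ₈.exec (ρ₇.exec (ρ₆.exec (ρ₅.exec
    (ρ₄.exec (ρ₃.exec (ρ₂.exec (ρ₁.exec σ))))))))) 7 Q ownC i₇ _ ∧ ∀ p, ρ₉.exec (ρ₈.exec (ρ₇.exec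
    (ρ₆.exec (ρ₅.exec (ρ₄.exec (ρ₃.exec (ρ₂.exec (ρ₁.exec σ)))))))) p _ = 1
  obtain ⟨u₁, v₁⟩ := h₁ S σ
  set σ₁ := ρ₁.exec σ
  obtain ⟨u₂, v₂⟩ := h₂ S σ₁
  set σ₂ := ρ₂.exec σ₁
  obtain ⟨u₃, v₃⟩ := h₃ S σ₂
  set σ₃ := ρ₃.exec σ₂
  obtain ⟨u₄, v₄⟩ := h₄ S σ₃
  set σ₄ := ρ₄.exec σ₃
  obtain ⟨u₅, v₅⟩ := h₅ S σ₄
  set σ₅ := ρ₅.exec σ₄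
  obtain ⟨u₆, v₆⟩ := h₆ S σ₅
  set σ₆ := ρ₆.exec σ₅
  obtain ⟨u₇, v₇⟩ := h₇ S σ₆
  set σ₇ := ρ₇.exec σ₆
  obtain ⟨u₈, v₈⟩ := h₈ S σ₇
  set σ₈ := ρ₈.exec σ₇
  obtain ⟨u₉, v₉⟩ := h₉ S σ₈
  set σ₉ := ρ₉.exec σ₈
  have keep : ∀ p k j, k = 0 ∨ k = 7 ∨ k = 8 → σ₈ p (reg (k, j)) = σ p (reg (k, j)) ∧
      σ₆ p (reg (k, j)) = σ p (reg (k, j)) := by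
    intro p k j hk
    have h : k ≠ 1 ∧ k ≠ 2 ∧ k ≠ 3 ∧ k ≠ 4 ∧ k ≠ 5 ∧ k ≠ 6 ∧ k ≠ 9 := by
      rcases hk with rfl | rfl | rfl <;> decide
    obtain ⟨a₁, a₂, a₃, a₄, a₅, a₆, a₉⟩ := h
    have h : σ₆ p (reg (k, j)) = σ p (reg (k, j)) := by
      rw [v₆ p k j a₅, v₅ p k j a₄, v₄ p k j a₃ a₉, v₃ p k j a₃, v₂ p k j a₂, v₁ p k j a₁]
    exact ⟨by rw [v₈ p k j a₆, v₇ p k j a₅ a₉, h], h⟩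
  have hin : ∀ x ∈ D, σ₃ x.2 (reg (2, i₂ x)) = val x.1 := by
    intro x hx
    rw [v₃ _ _ _ (by decide), u₂ x hx, u₁ _ (hDX x hx), hval _ (hDX x hx)]
  have hpart : ∀ x ∈ G, σ₆ (homeC x.1) (reg (4, i₄ x)) =
      ∑ t ∈ T with (out t, proc t) = x, val (in₁ t) * val (in₂ t) := by
    intro x hx
    rw [v₆ _ _ _ (by decide), u₅ x hx, u₄, u₃, zero_add]
    have hfilter : (T.filter fun t => proc t = x.2 ∧ i₃ (out t, proc t) = i₃ x) =
        T.filter fun t => (out t, proc t) = x := by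
      refine filter_congr fun t ht => ⟨fun h => hi₃ _ (hout t ht) _ hx h.1 h.2, ?_⟩
      rintro rfl
      exact ⟨rfl, rfl⟩
    rw [hfilter]
    refine sum_congr rfl fun t ht => ?_
    obtain ⟨ht', rfl⟩ := mem_filter.1 ht
    dsimp only
    rw [hin _ (hin₁ t ht'), hin _ (hin₂ t ht')]
  have hsum : ∀ f ∈ Q, σ₇ (homeC f) (reg (5, i₅ f)) =
      ∑ t ∈ T with out t = f, val (in₁ t) * val (in₂ t) := by
    intro f hf
    rw [u₇, u₆, zero_add]
    have hfilter : (G.filter fun x => homeC x.1 = homeC f ∧ i₅ x.1 = i₅ f) =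
        G.filter fun x => x.1 = f := by
      refine filter_congr fun x hx => ⟨fun h => hi₅ _ (hGQ x hx) _ hf h.1 h.2, ?_⟩
      rintro rfl
      exact ⟨rfl, rfl⟩
    rw [hfilter, ← sum_fiberwise_of_maps_to (s := T.filter fun t => out t = f)
      (t := G.filter fun x => x.1 = f) (g := fun t => (out t, proc t))]
    · refine sum_congr rfl fun x hx => ?_
      obtain ⟨hx', rfl⟩ := mem_filter.1 hx
      rw [hpart x hx', (keep _ 8 _ (by simp)).2, hone, mul_one, filter_filter]
      refine sum_congr (filter_congr fun t _ => ⟨fun h => ⟨by rw [← h], h⟩, fun h => h.2⟩)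
        fun _ _ => rfl
    · intro t ht
      obtain ⟨ht', rfl⟩ := mem_filter.1 ht
      exact mem_filter.2 ⟨hout t ht', rfl⟩
  refine ⟨fun e he => ?_, fun f hf => ?_, fun p => ?_⟩
  · rw [v₉ _ _ _ (by decide) (by decide), (keep _ 0 _ (by simp)).1, hval e he]
  · rw [u₉, (keep _ 7 _ (by simp)).1, hacc f hf]
    have hfilter : (Q.filter fun e => ownC e = ownC f ∧ i₇ e = i₇ f) = {f} := by
      ext e
      simp only [mem_filter, mem_singleton]
      constructor
      · exact fun h => hi₇ e h.1 f hf h.2.1 h.2.2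
      · rintro rfl
        exact ⟨hf, rfl, rfl⟩
    rw [hfilter, sum_singleton, (keep _ 8 _ (by simp)).1, hone, mul_one, u₈ f hf, hsum f hf]
  · rw [v₉ _ _ _ (by decide) (by decide), (keep _ 8 _ (by simp)).1, hone]

/-- Balanced intermediate places for words with few requests. -/
theorem exists_homes {ι : Type*} [DecidableEq ι] {n d b : ℕ} (hd : 1 ≤ d) (hb : 0 < b)
    (own : ι → Fin n) (X : Finset ι) (D : Finset (ι × Fin n)) (hDX : ∀ x ∈ D, x.1 ∈ X)
    (hcard : X.card + D.card ≤ n * b) (hload : ∀ e ∈ X, (D.filter fun x => x.1 = e).card ≤ d) :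
    ∃ home : ι → Fin n, (∀ p, (X.filter fun e => home e = p).card ≤ b + 2 * d) ∧
      ∀ p, (D.filter fun x => home x.1 = p).card ≤ b + 2 * d := by
  -- A word weighs one for its storage plus one per request, so a chunk bounds both loads of a home.
  -- The storage unit also keeps every weight positive, which forces `f e < n` below.
  obtain ⟨f, hf, hf'⟩ := exists_chunks X (fun e => 1 + (D.filter fun x => x.1 = e).card) b (2 * d)
    hb fun e he => by have := hload e he; omega
  have hsum : ∑ e ∈ X, (1 + (D.filter fun x => x.1 = e).card) ≤ n * b := by
    rw [sum_add_distrib, ← card_eq_sum_card_fiberwise hDX]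
    simpa using hcard
  have hlt : ∀ e ∈ X, f e < n := fun e he => by
    have := (hf e he).trans hsum
    exact Nat.lt_of_mul_lt_mul_right (a := b) (by omega)
  have hfilter : ∀ p : Fin n, (X.filter fun e =>
      (if h : f e < n then (⟨f e, h⟩ : Fin n) else own e) = p) = X.filter fun e => f e = p :=
    fun p => filter_congr fun e he => by rw [dif_pos (hlt e he), Fin.ext_iff]
  refine ⟨fun e => if h : f e < n then ⟨f e, h⟩ else own e, fun p => ?_, fun p => ?_⟩
  · rw [hfilter, card_eq_sum_ones]
    exact (sum_le_sum fun e _ => by omega).trans (hf' p)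
  · rw [card_eq_sum_card_fiberwise (f := Prod.fst) (t := X.filter fun e => f e = p)]
    · refine (sum_le_sum fun e _ => ?_).trans (hf' p)
      refine (card_le_card (filter_subset_filter _ (filter_subset _ _))).trans ?_
      omega
    · intro x hx
      obtain ⟨hx, hp⟩ := mem_filter.1 (mem_coe.1 hx)
      rw [← hfilter]
      exact mem_coe.2 (mem_filter.2 ⟨hDX x hx, hp⟩)

/-- A round which writes `1` to a register of every processor. -/
theorem exists_setOne.{v} (n : ℕ) {M : ℕ} (r : Fin M) :
    ∃ ρ : Round n M, ∀ (S : Type v) [Semiring S] (σ : Fin n → Fin M → S),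
      (∀ p, ρ.exec σ p r = 1) ∧ ∀ p q, q ≠ r → ρ.exec σ p q = σ p q :=
  ⟨Round.ofCompute fun _ => [.one r], fun S _ σ => ⟨fun p => by
    simp [Round.ofCompute_exec, runLocal, Instr.exec], fun p q hq => by
    simp [Round.ofCompute_exec, runLocal, Instr.exec, hq]⟩⟩

/-- A family of compact tasks, one for each processor, can be carried out in nine rounds. -/
theorem exists_rounds_of_compact.{v} {n d M : ℕ} (hd : 1 ≤ d) {EA EB Q : Finset (Fin n × Fin n)}
    (hA : Sparse d EA) (hB : Sparse d EB) (hQ : RowSparse d Q)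
    {own : (Fin n × Fin n) ⊕ (Fin n × Fin n) → Fin n} {ownC : Fin n × Fin n → Fin n}
    (hown : ∀ p, ((EA.disjSum EB).filter fun e => own e = p).card ≤ 14 * d)
    (hs : 0 < 14 * d) {reg : Fin 10 × Fin (14 * d) → Fin M} (hreg : Function.Injective reg)
    (i₀ : (Fin n × Fin n) ⊕ (Fin n × Fin n) → Fin (14 * d)) {i₇ : Fin n × Fin n → Fin (14 * d)}
    (hi₇ : ∀ e ∈ Q, ∀ f ∈ Q, ownC e = ownC f → i₇ e = i₇ f → e = f)
    {T : Finset (Fin n × Fin n × Fin n)} (hT : T ⊆ triangles EA EB Q)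
    (proc : Fin n × Fin n × Fin n → Fin n)
    (hcompact : ∀ p, Compact (5 * d) (T.filter fun t => proc t = p)) :
    ∃ L : List (Round n M), L.length = 9 ∧
      ∀ (S : Type v) [Semiring S] (σ : Fin n → Fin M → S)
        (val : (Fin n × Fin n) ⊕ (Fin n × Fin n) → S) (acc : Fin n × Fin n → S),
        Stores reg σ 0 (EA.disjSum EB) own i₀ val → Stores reg σ 7 Q ownC i₇ acc →
        (∀ p, σ p (reg (8, ⟨0, hs⟩)) = 1) →
        Stores reg (runRounds L σ) 0 (EA.disjSum EB) own i₀ val ∧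
          Stores reg (runRounds L σ) 7 Q ownC i₇ (fun f => acc f + ∑ t ∈ T with outPos t = f,
            val (Sum.inl (leftPos t)) * val (Sum.inr (rightPos t))) ∧
          ∀ p, runRounds L σ p (reg (8, ⟨0, hs⟩)) = 1 := by
  set X := EA.disjSum EB with hX
  set D := T.image (fun t => ((Sum.inl (leftPos t) : (Fin n × Fin n) ⊕ (Fin n × Fin n)), proc t)) ∪
    T.image (fun t => ((Sum.inr (rightPos t) : (Fin n × Fin n) ⊕ (Fin n × Fin n)), proc t)) with hD
  set G := T.image (fun t => (outPos t, proc t)) with hG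
  have hDX : ∀ x ∈ D, x.1 ∈ X := by
    intro x hx
    rcases mem_union.1 hx with hx | hx <;> obtain ⟨t, ht, rfl⟩ := mem_image.1 hx
    · simpa [hX] using (mem_triangles.1 (hT ht)).1
    · simpa [hX] using (mem_triangles.1 (hT ht)).2.1
  have hGQ : ∀ x ∈ G, x.1 ∈ Q := by
    intro x hx
    obtain ⟨t, ht, rfl⟩ := mem_image.1 hx
    exact (mem_triangles.1 (hT ht)).2.2
  have hDp : ∀ p, (D.filter fun x => x.2 = p).card ≤ 10 * d := by
    intro p
    have h : (D.filter fun x => x.2 = p) ⊆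
        ((T.filter fun t => proc t = p).image leftPos).image (fun e => (Sum.inl e, p)) ∪
          ((T.filter fun t => proc t = p).image rightPos).image (fun e => (Sum.inr e, p)) := by
      intro x hx
      obtain ⟨hx', rfl⟩ := mem_filter.1 hx
      rcases mem_union.1 hx' with hx | hx <;> obtain ⟨t, ht, rfl⟩ := mem_image.1 hx
      · exact mem_union_left _ (mem_image_of_mem _ (mem_image_of_mem _ (mem_filter.2 ⟨ht, rfl⟩)))
      · exact mem_union_right _ (mem_image_of_mem _ (mem_image_of_mem _ (mem_filter.2 ⟨ht, rfl⟩)))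
    have h₁ := (hcompact p).1
    have h₂ := (hcompact p).2.1
    have h₃ := (card_le_card h).trans (card_union_le _ _)
    have h₄ := card_image_le (s := (T.filter fun t => proc t = p).image leftPos)
      (f := fun e => ((Sum.inl e : (Fin n × Fin n) ⊕ (Fin n × Fin n)), p))
    have h₅ := card_image_le (s := (T.filter fun t => proc t = p).image rightPos)
      (f := fun e => ((Sum.inr e : (Fin n × Fin n) ⊕ (Fin n × Fin n)), p))
    omega
  have hGp : ∀ p, (G.filter fun x => x.2 = p).card ≤ 5 * d := by
    intro p
    have h : (G.filter fun x => x.2 = p) ⊆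
        ((T.filter fun t => proc t = p).image outPos).image (fun e => (e, p)) := by
      intro x hx
      obtain ⟨hx', rfl⟩ := mem_filter.1 hx
      obtain ⟨t, ht, rfl⟩ := mem_image.1 hx'
      exact mem_image_of_mem _ (mem_image_of_mem _ (mem_filter.2 ⟨ht, rfl⟩))
    exact (card_le_card h).trans (card_image_le.trans (hcompact p).2.2)
  have hDc : D.card ≤ n * (10 * d) := by
    have := card_le_mul_card_image_of_maps_to (f := Prod.snd) (s := D) (t := univ)
      (fun _ _ => mem_univ _) (10 * d) fun p _ => hDp p
    rwa [card_univ, Fintype.card_fin, mul_comm] at this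
  have hGc : G.card ≤ n * (5 * d) := by
    have := card_le_mul_card_image_of_maps_to (f := Prod.snd) (s := G) (t := univ)
      (fun _ _ => mem_univ _) (5 * d) fun p _ => hGp p
    rwa [card_univ, Fintype.card_fin, mul_comm] at this
  have hXc : X.card ≤ n * d + n * d := by
    rw [hX, card_disjSum]
    exact Nat.add_le_add hA.1.card_le hB.1.card_le
  have hloadD : ∀ e ∈ X, (D.filter fun x => x.1 = e).card ≤ d := by
    rintro (e | e) -
    · have h : (D.filter fun x => x.1 = Sum.inl e) ⊆
          ((triangles EA EB Q).filter fun t => leftPos t = e).image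
            fun t => (Sum.inl (leftPos t), proc t) := by
        intro x hx
        obtain ⟨hx, he⟩ := mem_filter.1 hx
        rcases mem_union.1 hx with hx | hx <;> obtain ⟨t, ht, rfl⟩ := mem_image.1 hx
        · exact mem_image_of_mem _ (mem_filter.2 ⟨hT ht, Sum.inl_injective he⟩)
        · simp at he
      exact (card_le_card h).trans (card_image_le.trans (card_triangles_leftPos_le hB e))
    · have h : (D.filter fun x => x.1 = Sum.inr e) ⊆
          ((triangles EA EB Q).filter fun t => rightPos t = e).image
            fun t => (Sum.inr (rightPos t), proc t) := by
        intro x hx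
        obtain ⟨hx, he⟩ := mem_filter.1 hx
        rcases mem_union.1 hx with hx | hx <;> obtain ⟨t, ht, rfl⟩ := mem_image.1 hx
        · simp at he
        · exact mem_image_of_mem _ (mem_filter.2 ⟨hT ht, Sum.inr_injective he⟩)
      exact (card_le_card h).trans (card_image_le.trans (card_triangles_rightPos_le hA e))
  have hloadG : ∀ e ∈ Q, (G.filter fun x => x.1 = e).card ≤ d := by
    intro e _
    have h : (G.filter fun x => x.1 = e) ⊆
        ((triangles EA EB Q).filter fun t => outPos t = e).image
          fun t => (outPos t, proc t) := by
      intro x hx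
      obtain ⟨hx, he⟩ := mem_filter.1 hx
      obtain ⟨t, ht, rfl⟩ := mem_image.1 hx
      exact mem_image_of_mem _ (mem_filter.2 ⟨hT ht, he⟩)
    exact (card_le_card h).trans (card_image_le.trans (card_triangles_outPos_le hA e))
  -- Per processor there are on average at most `2 * d` inputs and `10 * d` requests; the chunk
  -- overshoot `2 * d` gives the region size `14 * d`.
  obtain ⟨home, hhome, hhomeD⟩ := exists_homes hd (b := 12 * d) (by omega) own X D hDX
    (by linarith) hloadD
  obtain ⟨homeC, hhomeC, hhomeG⟩ := exists_homes hd (b := 6 * d) (by omega) ownC Q G hGQ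
    (by linarith [hQ.card_le]) hloadG
  exact exists_rounds_of_homes.{v} hs hreg (in₁ := fun t => Sum.inl (leftPos t))
    (in₂ := fun t => Sum.inr (rightPos t)) hown hi₇ hDX hGQ
    (fun t ht => mem_union_left _ (mem_image_of_mem _ ht))
    (fun t ht => mem_union_right _ (mem_image_of_mem _ ht))
    (fun t ht => mem_image_of_mem _ ht)
    (fun p => (hDp p).trans (by omega)) (fun p => (hGp p).trans (by omega))
    (fun p => (hhome p).trans (by omega)) (fun p => (hhomeD p).trans (by omega))
    (fun p => (hhomeC p).trans (by omega)) (fun p => (hhomeG p).trans (by omega))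

/-- If the triangles are coloured with compact colour classes, then the triangles of the first
`m * n` colours can be processed in `9 * m` rounds. -/
theorem exists_rounds_of_coloring.{v} {n d M : ℕ} (hd : 1 ≤ d) {EA EB Q : Finset (Fin n × Fin n)}
    (hA : Sparse d EA) (hB : Sparse d EB) (hQ : RowSparse d Q)
    {own : (Fin n × Fin n) ⊕ (Fin n × Fin n) → Fin n} {ownC : Fin n × Fin n → Fin n}
    (hown : ∀ p, ((EA.disjSum EB).filter fun e => own e = p).card ≤ 14 * d)
    (hs : 0 < 14 * d) {reg : Fin 10 × Fin (14 * d) → Fin M} (hreg : Function.Injective reg)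
    (i₀ : (Fin n × Fin n) ⊕ (Fin n × Fin n) → Fin (14 * d)) {i₇ : Fin n × Fin n → Fin (14 * d)}
    (hi₇ : ∀ e ∈ Q, ∀ f ∈ Q, ownC e = ownC f → i₇ e = i₇ f → e = f)
    (f : Fin n × Fin n × Fin n → ℕ)
    (hf : ∀ c, Compact (5 * d) ((triangles EA EB Q).filter fun t => f t = c)) (m : ℕ) :
    ∃ L : List (Round n M), L.length = 9 * m ∧
      ∀ (S : Type v) [Semiring S] (σ : Fin n → Fin M → S)
        (val : (Fin n × Fin n) ⊕ (Fin n × Fin n) → S),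
        Stores reg σ 0 (EA.disjSum EB) own i₀ val → Stores reg σ 7 Q ownC i₇ (fun _ => 0) →
        (∀ p, σ p (reg (8, ⟨0, hs⟩)) = 1) →
        Stores reg (runRounds L σ) 0 (EA.disjSum EB) own i₀ val ∧
          Stores reg (runRounds L σ) 7 Q ownC i₇
            (fun e => ∑ t ∈ triangles EA EB Q with f t / n < m ∧ outPos t = e,
              val (Sum.inl (leftPos t)) * val (Sum.inr (rightPos t))) ∧
          ∀ p, runRounds L σ p (reg (8, ⟨0, hs⟩)) = 1 := by
  induction m with
  | zero =>
    refine ⟨[], rfl, fun S _ σ val h₀ h₇ h₈ => ⟨h₀, ?_, h₈⟩⟩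
    simpa [runRounds] using h₇
  | succ m ih =>
    obtain ⟨L, hL, h⟩ := ih
    -- Batch `m` consists of the colours `n * m + p` with `p < n`, and processor `p` handles colour
    -- `n * m + p`.
    obtain ⟨L', hL', h'⟩ := exists_rounds_of_compact.{v} hd hA hB hQ hown hs hreg i₀ hi₇
      (T := (triangles EA EB Q).filter fun t => f t / n = m) (filter_subset _ _)
      (fun t => ⟨f t % n, Nat.mod_lt _ t.1.pos⟩) fun p => (hf (n * m + p)).mono fun t ht => by
        simp only [mem_filter, Fin.ext_iff] at ht ⊢
        refine ⟨ht.1.1, ?_⟩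
        rw [← ht.1.2, ← ht.2, Nat.div_add_mod]
    refine ⟨L ++ L', by rw [List.length_append, hL, hL']; ring, fun S _ σ val h₀ h₇ h₈ => ?_⟩
    obtain ⟨g₀, g₇, g₈⟩ := h S σ val h₀ h₇ h₈
    have hrun : runRounds (L ++ L') σ = runRounds L' (runRounds L σ) := List.foldl_append
    rw [hrun]
    obtain ⟨k₀, k₇, k₈⟩ := h' S (runRounds L σ) val _ g₀ g₇ g₈
    refine ⟨k₀, ?_, k₈⟩
    convert k₇ using 2 with e
    rw [filter_filter, ← sum_union]
    · rw [← filter_or]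
      refine sum_congr (filter_congr fun t _ => ?_) fun _ _ => rfl
      rw [Nat.lt_succ_iff_lt_or_eq, or_and_right]
    · rw [disjoint_filter]
      rintro t - h₁ h₂
      omega

/-! ### Correctness of the sum and the round count. -/

/-- The products at the triangles add up to the entries of the product. -/
theorem sum_triangles_eq_mul {n : ℕ} {S : Type*} [Semiring S] {EA EB Q : Finset (Fin n × Fin n)}
    {A B : Matrix (Fin n) (Fin n) S} (hA : SupportedOn A EA) (hB : SupportedOn B EB)
    {e : Fin n × Fin n} (he : e ∈ Q) :
    ∑ t ∈ triangles EA EB Q with outPos t = e, A t.1 t.2.1 * B t.2.1 t.2.2 =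
      (A * B) e.1 e.2 := by
  rw [Matrix.mul_apply]
  have h : ((triangles EA EB Q).filter fun t => outPos t = e) ⊆
      univ.image fun j => (e.1, j, e.2) := by
    rintro ⟨i, j, k⟩ ht
    obtain ⟨-, rfl⟩ := mem_filter.1 ht
    exact mem_image_of_mem _ (mem_univ j)
  rw [sum_subset h, sum_image]
  · intro j _ j' _ hj
    simpa using hj
  · intro t ht ht'
    obtain ⟨j, -, rfl⟩ := mem_image.1 ht
    by_contra hne
    refine ht' (mem_filter.2 ⟨mem_triangles.2 ⟨hA _ _ fun h₀ => ?_, hB _ _ fun h₀ => ?_, he⟩, rfl⟩)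
    · exact hne (by simp only [h₀, zero_mul])
    · exact hne (by simp only [h₀, mul_zero])

/-- The integer part of the tenth root. -/
theorem exists_tenth_root {d : ℕ} (hd : 1 ≤ d) :
    ∃ r : ℕ, 1 ≤ r ∧ r ^ 10 ≤ d ∧ (d : ℝ) ≤ 2 * r * (d : ℝ) ^ (0.9 : ℝ) := by
  have hd₀ : (0 : ℝ) < d := by exact_mod_cast hd
  have h₁ : (1 : ℝ) ≤ (d : ℝ) ^ (0.1 : ℝ) :=
    Real.one_le_rpow (by exact_mod_cast hd) (by norm_num)
  have hr : 1 ≤ ⌊(d : ℝ) ^ (0.1 : ℝ)⌋₊ := Nat.le_floor (by exact_mod_cast h₁)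
  refine ⟨⌊(d : ℝ) ^ (0.1 : ℝ)⌋₊, hr, ?_, ?_⟩
  · have h : ((⌊(d : ℝ) ^ (0.1 : ℝ)⌋₊ : ℝ)) ^ 10 ≤ ((d : ℝ) ^ (0.1 : ℝ)) ^ 10 :=
      pow_le_pow_left₀ (Nat.cast_nonneg _) (Nat.floor_le (by positivity)) 10
    rw [← Real.rpow_natCast ((d : ℝ) ^ (0.1 : ℝ)), ← Real.rpow_mul hd₀.le] at h
    rw [show (0.1 : ℝ) * (10 : ℕ) = 1 by norm_num, Real.rpow_one] at h
    exact_mod_cast h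
  -- Rounding down a number that is at least one loses at most a factor of two.
  · have h : (d : ℝ) ^ (0.1 : ℝ) ≤ 2 * ⌊(d : ℝ) ^ (0.1 : ℝ)⌋₊ := by
      have h₂ := (Nat.lt_floor_add_one ((d : ℝ) ^ (0.1 : ℝ))).le
      have h₃ : (1 : ℝ) ≤ ⌊(d : ℝ) ^ (0.1 : ℝ)⌋₊ := by exact_mod_cast hr
      linarith
    calc (d : ℝ) = (d : ℝ) ^ (0.1 : ℝ) * (d : ℝ) ^ (0.9 : ℝ) := by
          rw [← Real.rpow_add hd₀]; norm_num
      _ ≤ _ := mul_le_mul_of_nonneg_right h (by positivity)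

end MPC

theorem mainTheorem5 :
    ∃ c K : ℕ, ∀ (n d : ℕ), 1 ≤ d →
      ∀ EA EB Q : Finset (Fin n × Fin n),
        MPC.Sparse d EA → MPC.Sparse d EB → MPC.RowSparse d Q →
        ∀ ownA ownB ownC : Fin n × Fin n → Fin n,
          MPC.EvenlyDistributed d EA ownA → MPC.EvenlyDistributed d EB ownB →
          MPC.EvenlyDistributed d Q ownC →
          ∃ alg : MPC.MulAlgorithm n (c * d),
            alg.StartsFrom ownA ownB ∧
            MPC.MulAlgorithm.Computes.{u} alg EA EB Q ownC ∧
            (alg.rounds.length : ℝ) ≤ K * (d : ℝ) ^ (0.9 : ℝ) := by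
  classical
  -- Ten regions of `14 * d` registers; `1660 = 2 * 830`, with the factor two from rounding the
  -- tenth root.
  refine ⟨140, 1660, fun n d hd EA EB Q hA hB hQ ownA ownB ownC hownA hownB hownC => ?_⟩
  obtain ⟨r, hr₁, hrd, hdr⟩ := MPC.exists_tenth_root hd
  obtain ⟨f, N, hfN, hf, hN⟩ := MPC.exists_coloring hd hrd hA hB hQ (MPC.triangles EA EB Q) le_rfl
  have hs : 0 < 14 * d := by omega
  let reg : Fin 10 × Fin (14 * d) → Fin (140 * d) := fun x =>
    Fin.cast (by ring) (finProdFinEquiv x)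
  have hreg : Function.Injective reg := (Fin.cast_injective _).comp finProdFinEquiv.injective
  set own : (Fin n × Fin n) ⊕ (Fin n × Fin n) → Fin n := Sum.elim ownA ownB with hown_def
  have hown : ∀ p, ((EA.disjSum EB).filter fun e => own e = p).card ≤ 14 * d := by
    intro p
    have h : ((EA.disjSum EB).filter fun e => own e = p) =
        (EA.filter fun e => ownA e = p).disjSum (EB.filter fun e => ownB e = p) := by
      ext (e | e) <;> simp [hown_def]
    rw [h, card_disjSum]
    have := hownA p
    have := hownB p
    omega
  obtain ⟨i₀, hi₀⟩ := MPC.exists_slots hs (EA.disjSum EB) own hown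
  obtain ⟨i₇, hi₇⟩ := MPC.exists_slots hs Q ownC fun p => (hownC p).trans (by omega)
  obtain ⟨ρ, hρ⟩ := MPC.exists_setOne.{u} n (reg (8, ⟨0, hs⟩))
  obtain ⟨L, hL, h⟩ := MPC.exists_rounds_of_coloring.{u} hd hA hB hQ hown hs hreg i₀ hi₇ f hf
    (N / n + 1)
  let load : Fin n → Fin (140 * d) → Option ((Fin n × Fin n) ⊕ (Fin n × Fin n)) := fun p q =>
    if h : ∃ e ∈ EA.disjSum EB, own e = p ∧ reg (0, i₀ e) = q then some h.choose else none
  have hload : ∀ p q e, load p q = some e → own e = p := by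
    intro p q e he
    simp only [load] at he
    split_ifs at he with h
    exact (Option.some.inj he) ▸ h.choose_spec.2.1
  have hload₀ : ∀ e ∈ EA.disjSum EB, load (own e) (reg (0, i₀ e)) = some e := by
    intro e he
    have h : ∃ e' ∈ EA.disjSum EB, own e' = own e ∧ reg (0, i₀ e') = reg (0, i₀ e) :=
      ⟨e, he, rfl, rfl⟩
    simp only [load]
    rw [dif_pos h, hi₀ _ h.choose_spec.1 e he h.choose_spec.2.1
      (Prod.ext_iff.1 (hreg h.choose_spec.2.2)).2]
  -- Registers without an entry hold zero, so the accumulators start correctly.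
  have hload₇ : ∀ p j, load p (reg (7, j)) = none := by
    intro p j
    simp only [load]
    rw [dif_neg]
    rintro ⟨e, -, -, he⟩
    exact absurd (Prod.ext_iff.1 (hreg he)).1 (show ¬(0 : Fin 10) = 7 by decide)
  refine ⟨⟨⟨ρ :: L, fun _ => []⟩, load, fun e => reg (7, i₇ e)⟩, fun p q e => ⟨hload p q _,
    hload p q _⟩, ⟨fun e he e' he' hp hq => hi₇ e he e' he' hp (Prod.ext_iff.1 (hreg hq)).2,
    fun S _ A B hAE hBE e he => ?_⟩, ?_⟩
  · set alg : MPC.MulAlgorithm n (140 * d) :=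
      ⟨⟨ρ :: L, fun _ => []⟩, load, fun e => reg (7, i₇ e)⟩ with halg
    set val : (Fin n × Fin n) ⊕ (Fin n × Fin n) → S :=
      Sum.elim (fun e => A e.1 e.2) (fun e => B e.1 e.2) with hval
    have hne : ∀ k i, k ≠ 8 → reg (k, i) ≠ reg (8, ⟨0, hs⟩) :=
      fun k i hk h => hk (Prod.ext_iff.1 (hreg h)).1
    obtain ⟨hone, hkeep⟩ := hρ S (alg.init A B)
    have h₀ : MPC.Stores reg (ρ.exec (alg.init A B)) 0 (EA.disjSum EB) own i₀ val := by
      intro x hx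
      rw [hkeep _ _ (hne 0 _ (by decide))]
      have hx' : alg.load (own x) (reg (0, i₀ x)) = some x := hload₀ x hx
      simp only [MPC.MulAlgorithm.init, hx']
      rcases x with x | x <;> rfl
    have h₇ : MPC.Stores reg (ρ.exec (alg.init A B)) 7 Q ownC i₇ (fun _ => 0) := by
      intro x _
      rw [hkeep _ _ (hne 7 _ (by decide))]
      have hx' : alg.load (ownC x) (reg (7, i₇ x)) = none := hload₇ _ _
      simp only [MPC.MulAlgorithm.init, hx']
    obtain ⟨-, hres, -⟩ := h S (ρ.exec (alg.init A B)) val h₀ h₇ hone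
    refine (hres e he).trans ?_
    rw [← MPC.sum_triangles_eq_mul hAE hBE he]
    refine sum_congr (filter_congr fun t ht => and_iff_right ?_) fun _ _ => rfl
    have := Nat.div_le_div_right (c := n) (hfN t ht).le
    omega
  · have hrd' : r ≤ d := (Nat.le_self_pow (by norm_num) r).trans hrd
    have hT := MPC.card_triangles_le (Q := Q) hA hB
    have hNr : N / n * r ≤ 82 * d := by
      -- For `n = 0` the quotient `N / n` is zero by convention.
      rcases Nat.eq_zero_or_pos n with rfl | hn
      · simp
      have h₁ : N * r ≤ 81 * (n * d) + r := by
        refine Nat.le_of_mul_le_mul_left (c := d) ?_ hd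
        calc d * (N * r) = N * (d * r) := by ring
          _ ≤ 81 * (n * d * d) + d * r := by omega
          _ = d * (81 * (n * d) + r) := by ring
      refine Nat.le_of_mul_le_mul_left (c := n) ?_ hn
      calc n * (N / n * r) = N / n * n * r := by ring
        _ ≤ N * r := Nat.mul_le_mul_right r (Nat.div_mul_le_self N n)
        _ ≤ 81 * (n * d) + r := h₁
        _ ≤ 81 * (n * d) + n * d := by
          have := Nat.mul_le_mul hn hrd'
          omega
        _ = n * (82 * d) := by ring
    -- Nine rounds per batch and one for the constant: `9 * 82 + 10 = 748`, which leaves some slack.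
    have hlen : (ρ :: L).length * r ≤ 830 * d := by
      rw [List.length_cons, hL]
      calc (9 * (N / n + 1) + 1) * r = 9 * (N / n * r) + 10 * r := by ring
        _ ≤ 830 * d := by omega
    have hr₀ : (0 : ℝ) < r := by exact_mod_cast hr₁
    refine le_of_mul_le_mul_right ?_ hr₀
    calc ((ρ :: L).length : ℝ) * r ≤ 830 * d := by exact_mod_cast hlen
      _ ≤ 830 * (2 * r * (d : ℝ) ^ (0.9 : ℝ)) := by linarith
      _ = ((1660 : ℕ) : ℝ) * (d : ℝ) ^ (0.9 : ℝ) * r := by push_cast; ring
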